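/- Let $X,\Omega$ be locally compact Hausdorff spaces, $\phi\in C_0(X\times\Omega)$ real-valued, and let $(\mathcal U,\mathcal U^\diamond)$ be a dual pair of real Banach spaces with a continuous pairing, i.e. a continuous bilinear form $\langle\cdot,\cdot\rangle_{\mathcal U}\colon\mathcal U^\diamond\times\mathcal U\to\mathbb R$ that is nondegenerate in both arguments. For a Banach space $E$ and a locally compact Hausdorff space $S$ let $\mathcal M(S;E)$ be the space of countably additive $E$-valued Borel measures $\mu$ on $S$ whose total variation measure $|\mu|$ is finite and regular. For $\mu\in\mathcal M(\Omega;\mathcal U)$ and $\rho\in\mathcal M(X;\mathcal U^\diamond)$ put $$(A\mu)(x)=\int_\Omega\phi(x,w)\,d\mu(w),\qquad (A^\diamond\rho)(w)=\int_X\phi(x,w)\,d\rho(x),$$ and let $\langle\rho,\mu\rangle_{\mathcal U}$ be the signed measure on $X\times\Omega$ (with the product $\sigma$-algebra) with $\langle\rho,\mu\rangle_{\mathcal U}(E\times F)=\langle\rho(E),\mu(F)\rangle_{\mathcal U}$ for Borel sets $E\subseteq X$, $F\subseteq\Omega$. Define $$\mathcal B=\{A\mu\mid\mu\in\mathcal M(\Omega;\mathcal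 U)\},\quad \|f\|_{\mathcal B}=\inf_{f=A\mu}|\mu|(\Omega),\qquad \mathcal B_0^\diamond=\{A^\diamond\rho\mid\rho\in\mathcal M(X;\mathcal U^\diamond)\},\quad \|g\|_{\mathcal B^\diamond}=\sup_{w\in\Omega}\|g(w)\|_{\mathcal U^\diamond},$$ and let $\mathcal B^\diamond$ be the closure of $\mathcal B_0^\diamond$ under uniform convergence on $\Omega$ (equivalently, its completion in the supremum norm), with the supremum norm. A vector space of functions from a set to a Banach space, with a complete norm for which all point evaluations are bounded, is called a vv-RKBS. A twin operator over $(\mathcal U,\mathcal U^\diamond)$ is a bounded bilinear form $T\colon\mathcal U^\diamond\times\mathcal U\to\mathbb R$ for which there are linear operators $T_{\mathcal U}$ on $\mathcal U$ and $T_{\mathcal U^\diamond}$ on $\mathcal U^\diamond$ with $\langle u^\diamond,T_{\mathcal U}u\rangle_{\mathcal U}=T(u^\diamond,u)=\langle T_{\mathcal U^\diamond}u^\diamond,u\rangle_{\mathcal U}$. Let $$K(x,w)(u^\diamond,u)=\phi(x,w)\langle u^\diamond,u\rangle_{\mathcal U},\qquad K_{\mathcal U}(x,w)u=\phi(x,w)u,\qquad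 K_{\mathcal U^\diamond}(x,w)u^\diamond=\phi(x,w)u^\diamond ;$$ each $K(x,w)$ is a twin operator. **Theorem.** There is a unique bilinear form $\langle\cdot,\cdot\rangle_{\mathcal B}\colon\mathcal B^\diamond\times\mathcal B\to\mathbb R$ with the following properties. 1. For all $\rho\in\mathcal M(X;\mathcal U^\diamond)$ and $\mu\in\mathcal M(\Omega;\mathcal U)$, $$\langle A^\diamond\rho,A\mu\rangle_{\mathcal B}=\int_{X\times\Omega}\phi\,d\langle\rho,\mu\rangle_{\mathcal U}.$$ 2. If $C$ is a constant with $|\langle u^\diamond,u\rangle_{\mathcal U}|\le C\|u^\diamond\|_{\mathcal U^\diamond}\|u\|_{\mathcal U}$ for all $u^\diamond,u$ (in particular, if $C$ is the smallest such constant), then $$|\langle g,f\rangle_{\mathcal B}|\le C\,\|g\|_{\mathcal B^\diamond}\|f\|_{\mathcal B}\qquad\text{for all } g\in\mathcal B^\diamond,\ f\in\mathcal B .$$ 3. $(\mathcal B,\mathcal B^\diamond)$ is an adjoint pair of vv-RKBSs with reproducing kernel $K$: $\mathcal B$ is a vv-RKBS of functions $X\to\mathcal U$ and $\mathcal B^\diamond$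 is a vv-RKBS of functions $\Omega\to\mathcal U^\diamond$; the pairing $\langle\cdot,\cdot\rangle_{\mathcal B}$ is continuous and nondegenerate in both arguments; for all $x\in X$, $u^\diamond\in\mathcal U^\diamond$, $w\in\Omega$, $u\in\mathcal U$ one has $K_{\mathcal U^\diamond}(x,\cdot)u^\diamond\in\mathcal B^\diamond$, $K_{\mathcal U}(\cdot,w)u\in\mathcal B$, and $$\langle u^\diamond,f(x)\rangle_{\mathcal U}=\langle K_{\mathcal U^\diamond}(x,\cdot)u^\diamond,f\rangle_{\mathcal B}\quad(f\in\mathcal B),\qquad \langle g(w),u\rangle_{\mathcal U}=\langle g,K_{\mathcal U}(\cdot,w)u\rangle_{\mathcal B}\quad(g\in\mathcal B^\diamond).$$ 4. All of this except completeness holds for $\mathcal B_0^\diamond$ itself: the supremum norm is a norm on $\mathcal B_0^\diamond$ with bounded point evaluations, the restriction of the pairing to $\mathcal B_0^\diamond\times\mathcal B$ is continuous and nondegenerate in both arguments, $K_{\mathcal U^\diamond}(x,\cdot)u^\diamond\in\mathcal B_0^\diamond$ for all $x,u^\diamond$, and both reproducing properties hold on $\mathcal B_0^\diamond$ and $\mathcal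 B$. -/

import Mathlib

open MeasureTheory Filter Topology
open scoped ZeroAtInfty

namespace VVRKBS

/-! ### General notions: vv-RKBS, twin operators, adjoint pairs -/

section General

variable {X Ω U Ud : Type*}
  [NormedAddCommGroup U] [NormedSpace ℝ U] [NormedAddCommGroup Ud] [NormedSpace ℝ Ud]

/-- `N` is a norm on the vector space `B` of functions `X → U`, and all point evaluations are
bounded with respect to `N` (completeness is not required here). -/
structure IsNormedFunctionSpace (B : Submodule ℝ (X → U)) (N : B → ℝ) : Prop where
  nonneg : ∀ f, 0 ≤ N f
  eq_zero_iff : ∀ f, N f = 0 ↔ f = 0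
  smul : ∀ (c : ℝ) (f : B), N (c • f) = |c| * N f
  add_le : ∀ f g, N (f + g) ≤ N f + N g
  eval_bounded : ∀ x, ∃ C : ℝ, 0 ≤ C ∧ ∀ f : B, ‖(f : X → U) x‖ ≤ C * N f

/-- `B`, a vector space of functions from `X` to the Banach space `U`, is a vector-valued
reproducing kernel Banach space with the norm `N`: `N` is a complete norm and all point
evaluations are bounded. -/
structure IsVVRKBS [CompleteSpace U] (B : Submodule ℝ (X → U)) (N : B → ℝ) : Prop
    extends IsNormedFunctionSpace B N where
  complete : ∀ s : ℕ → B,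
    (∀ ε > 0, ∃ n₀, ∀ m ≥ n₀, ∀ n ≥ n₀, N (s m - s n) < ε) →
      ∃ f, Tendsto (fun n => N (s n - f)) atTop (𝓝 0)

/-- Twin operators over a dual pair `(U, Ud)` with pairing `P`: bounded bilinear forms `T` on
`Ud × U` such that `T(ud, u) = ⟨ud, T_U u⟩ = ⟨T_Ud ud, u⟩` for linear operators `T_U` on `U` and
`T_Ud` on `Ud` (these are unique when `P` is nondegenerate). -/
structure TwinOperator (P : Ud →ₗ[ℝ] U →ₗ[ℝ] ℝ) where
  form : Ud →L[ℝ] U →L[ℝ] ℝ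
  opU : U →ₗ[ℝ] U
  opUd : Ud →ₗ[ℝ] Ud
  pairing_opU : ∀ ud u, P ud (opU u) = form ud u
  pairing_opUd : ∀ ud u, P (opUd ud) u = form ud u

/-- The conditions on the pairing `p = ⟨·,·⟩_B` and on the kernel `K` in the definition of an
adjoint pair of vv-RKBSs: `P` and `p` are dual pairings, `p` is continuous for the norms `N` and
`Nd`, and `K` has both reproducing properties. -/
structure IsReproducingPair (P : Ud →ₗ[ℝ] U →ₗ[ℝ] ℝ)
    (B : Submodule ℝ (X → U)) (N : B → ℝ) (Bd : Submodule ℝ (Ω → Ud)) (Nd : Bd → ℝ)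
    (p : Bd →ₗ[ℝ] B →ₗ[ℝ] ℝ) (K : X → Ω → TwinOperator P) : Prop where
  nondegenerate_output : P.Nondegenerate
  nondegenerate : p.Nondegenerate
  continuous : ∃ C : ℝ, 0 ≤ C ∧ ∀ g f, |p g f| ≤ C * Nd g * N f
  reproducing : ∀ x ud, ∃ h : (fun w => (K x w).opUd ud) ∈ Bd,
    ∀ f : B, P ud ((f : X → U) x) = p ⟨fun w => (K x w).opUd ud, h⟩ f
  reproducing_adjoint : ∀ w u, ∃ h : (fun x => (K x w).opU u) ∈ B,
    ∀ g : Bd, P ((g : Ω → Ud) w) u = p g ⟨fun x => (K x w).opU u, h⟩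

/-- `(B, Bd)`, with norms `N`, `Nd`, is an adjoint pair of vv-RKBSs over the dual pair of Banach
spaces `(U, Ud)` with pairing `P`, for the pairing `p` and the reproducing kernel `K`. -/
structure IsAdjointPair [CompleteSpace U] [CompleteSpace Ud] (P : Ud →ₗ[ℝ] U →ₗ[ℝ] ℝ)
    (B : Submodule ℝ (X → U)) (N : B → ℝ) (Bd : Submodule ℝ (Ω → Ud)) (Nd : Bd → ℝ)
    (p : Bd →ₗ[ℝ] B →ₗ[ℝ] ℝ) (K : X → Ω → TwinOperator P) : Prop
    extends IsReproducingPair P B N Bd Nd p K where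
  isVVRKBS : IsVVRKBS B N
  isVVRKBS_adjoint : IsVVRKBS Bd Nd

/-- The supremum norm on a space of functions. -/
noncomputable def supNorm (B : Submodule ℝ (Ω → Ud)) (g : B) : ℝ := ⨆ w, ‖(g : Ω → Ud) w‖

/-- The closure of a space of functions under uniform convergence. -/
def uniformClosure (B : Submodule ℝ (Ω → Ud)) : Submodule ℝ (Ω → Ud) where
  carrier := {g | ∀ ε > 0, ∃ h ∈ B, ∀ w, ‖g w - h w‖ ≤ ε}
  zero_mem' := fun ε hε => ⟨0, B.zero_mem, fun w => by simpa using hε.le⟩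
  add_mem' := by
    intro a b ha hb ε hε
    obtain ⟨a', ha', ha''⟩ := ha (ε / 2) (by positivity)
    obtain ⟨b', hb', hb''⟩ := hb (ε / 2) (by positivity)
    refine ⟨a' + b', B.add_mem ha' hb', fun w => ?_⟩
    calc ‖(a + b) w - (a' + b') w‖ = ‖(a w - a' w) + (b w - b' w)‖ := by
          congr 1; simp only [Pi.add_apply]; abel
      _ ≤ ‖a w - a' w‖ + ‖b w - b' w‖ := norm_add_le _ _
      _ ≤ ε := by linarith [ha'' w, hb'' w]
  smul_mem' := by
    intro c a ha ε hε
    obtain ⟨a', ha', ha''⟩ := ha (ε / (|c| + 1)) (by positivity)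
    refine ⟨c • a', B.smul_mem c ha', fun w => ?_⟩
    calc ‖(c • a) w - (c • a') w‖ = |c| * ‖a w - a' w‖ := by
          rw [Pi.smul_apply, Pi.smul_apply, ← smul_sub, norm_smul, Real.norm_eq_abs]
      _ ≤ (|c| + 1) * (ε / (|c| + 1)) := by
          gcongr
          · linarith
          · exact ha'' w
      _ = ε := by field_simp

theorem le_uniformClosure (B : Submodule ℝ (Ω → Ud)) : B ≤ uniformClosure B :=
  fun g hg ε hε => ⟨g, hg, fun w => by simpa using hε.le⟩

end General

/-! ### Vector measures and the integral vv-RKBS -/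

section Integral

/-- A finite measure dominated by a finite regular measure is regular. -/
theorem regular_of_le {α : Type*} [TopologicalSpace α] [T2Space α] [MeasurableSpace α]
    [BorelSpace α] {m n : Measure α} [IsFiniteMeasure n] (hn : n.Regular) (h : m ≤ n) :
    m.Regular := by
  have : IsFiniteMeasure m := isFiniteMeasure_of_le n h
  have : m.InnerRegularCompactLTTop := by
    refine ⟨?_⟩
    rintro s ⟨hs, -⟩ r hr
    obtain ⟨K, hKs, hK, hlt⟩ := hs.exists_isCompact_sdiff_lt (μ := n) (measure_ne_top n s)
      (ε := m s - r) (tsub_pos_of_lt hr).ne'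
    refine ⟨K, hKs, hK, ?_⟩
    have h1 : m (s \ K) < m s - r := (h _).trans_lt hlt
    have h2 : m s ≤ m K + m (s \ K) := by
      calc m s ≤ m (K ∪ s \ K) := measure_mono (by intro x hx; by_cases hk : x ∈ K <;> simp [hx, hk])
        _ ≤ _ := measure_union_le _ _
    by_contra hle
    have hle' : m K ≤ r := not_lt.1 hle
    have h3 : m s < r + (m s - r) :=
      (h2.trans (add_le_add_left hle' _)).trans_lt
        (ENNReal.add_lt_add_left (ne_top_of_lt hr) h1)
    rw [add_tsub_cancel_of_le hr.le] at h3
    exact lt_irrefl _ h3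
  infer_instance

/-- `M(Ω; E)`: the space of regular countably additive `E`-valued Borel measures of finite total
variation; regularity of a vector measure means regularity of its variation. -/
def regularMeasures (Ω E : Type*) [TopologicalSpace Ω] [T2Space Ω] [MeasurableSpace Ω]
    [BorelSpace Ω] [NormedAddCommGroup E] [NormedSpace ℝ E] :
    Submodule ℝ (VectorMeasure Ω E) where
  carrier := {μ | IsFiniteMeasure μ.variation ∧ μ.variation.Regular}
  zero_mem' := by
    simp only [Set.mem_ofPred_eq, VectorMeasure.variation_zero]
    exact ⟨inferInstance, inferInstance⟩
  add_mem' := by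
    rintro μ ν ⟨hμ, hμ'⟩ ⟨hν, hν'⟩
    have hle := VectorMeasure.variation_add_le (μ := μ) (ν := ν)
    have : (μ.variation + ν.variation).Regular := inferInstance
    exact ⟨isFiniteMeasure_of_le _ hle, regular_of_le this hle⟩
  smul_mem' := by
    rintro c μ ⟨hμ, hμ'⟩
    simp only [Set.mem_ofPred_eq, VectorMeasure.variation_smul]
    exact ⟨inferInstance, inferInstance⟩

variable {X Ω : Type*} [TopologicalSpace X] [TopologicalSpace Ω] [T2Space Ω]
  [MeasurableSpace Ω] [BorelSpace Ω]

theorem integrable_section (φ : C₀(X × Ω, ℝ)) (x : X) (m : Measure Ω) [IsFiniteMeasure m] :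
    Integrable (fun w => φ (x, w)) m := by
  have hc : Continuous fun w => φ (x, w) := φ.continuous.comp (by fun_prop)
  exact Integrable.of_bound hc.stronglyMeasurable.aestronglyMeasurable ‖φ.toBCF‖
    (Eventually.of_forall fun w => φ.toBCF.norm_coe_le_norm (x, w))

variable (E : Type*) [NormedAddCommGroup E] [NormedSpace ℝ E]

/-- The integral operator `(A μ)(x) = ∫ φ(x, w) dμ(w)` on `M(Ω; E)`. -/
noncomputable def integralOperator (φ : C₀(X × Ω, ℝ)) : regularMeasures Ω E →ₗ[ℝ] (X → E) where
  toFun μ := fun x => ∫ᵛ w, φ (x, w) ∂•(μ : VectorMeasure Ω E)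
  map_add' := by
    rintro ⟨μ, hμ, hμ'⟩ ⟨ν, hν, hν'⟩
    ext x
    exact VectorMeasure.integral_add_vectorMeasure (integrable_section φ x _)
      (integrable_section φ x _)
  map_smul' := by
    rintro c μ
    ext x
    exact VectorMeasure.integral_smul_vectorMeasure _ c

/-- The space `{A μ | μ ∈ M(Ω; E)}` of functions from `X` to `E`. -/
noncomputable def integralSpace (φ : C₀(X × Ω, ℝ)) : Submodule ℝ (X → E) :=
  LinearMap.range (integralOperator E φ)

/-- The norm `‖f‖ = inf {|μ|(Ω) | f = A μ}`. -/
noncomputable def integralNorm (φ : C₀(X × Ω, ℝ)) (f : integralSpace E φ) : ℝ :=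
  sInf {r | ∃ μ : regularMeasures Ω E, integralOperator E φ μ = f ∧
    r = (μ : VectorMeasure Ω E).variation.real Set.univ}

/-- The function `(w, x) ↦ φ(x, w)`. -/
def swap (φ : C₀(X × Ω, ℝ)) : C₀(Ω × X, ℝ) :=
  φ.comp ⟨⟨Prod.swap, continuous_swap⟩, (Homeomorph.prodComm Ω X).isClosedEmbedding.tendsto_cocompact⟩

end Integral

section Kernel

variable {X Ω U Ud : Type*} [TopologicalSpace X] [TopologicalSpace Ω]
  [NormedAddCommGroup U] [NormedSpace ℝ U] [NormedAddCommGroup Ud] [NormedSpace ℝ Ud]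

/-- The kernel `K(x, w)(ud, u) = φ(x, w) ⟨ud, u⟩`, with `K_U(x, w) u = φ(x, w) u` and
`K_Ud(x, w) ud = φ(x, w) ud`. -/
noncomputable def integralKernel (P : Ud →L[ℝ] U →L[ℝ] ℝ) (φ : C₀(X × Ω, ℝ)) (x : X) (w : Ω) :
    TwinOperator P.toLinearMap₁₂ where
  form := φ (x, w) • P
  opU := φ (x, w) • LinearMap.id
  opUd := φ (x, w) • LinearMap.id
  pairing_opU := by intro ud u; simp
  pairing_opUd := by intro ud u; simp

end Kernel

end VVRKBS

set_option linter.unusedSectionVars false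

/-! The pairing is ⟨g, Aμ⟩ = ∫ ⟨g(w), dμ(w)⟩, and the main point is that it depends on μ only
through Aμ. For g = A^⋄ρ, Fubini for vector measures (`integral_prod_eq`, `integral_prod_eq_symm`)
gives ∫ ⟨A^⋄ρ, dμ⟩ = ∫ φ d⟨ρ, μ⟩ = ∫ ⟨dρ, Aμ⟩, and the last integral sees only Aμ. Dominated
convergence carries this to uniform limits g (`integral_eq_of_integralOperator_eq`).

The bound holds for each representing μ, hence for the infimum. Dirac measures represent the kernel
sections, which yields both reproducing properties, and these reduce nondegeneracy to that of the
output pairing. The space of measures is complete in total variation, so its quotient B is complete;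
the adjoint space is complete as a space of uniform limits. Uniqueness: the product formula fixes
the pairing on A^⋄ρ, and the bound extends it to the closure. -/

namespace VVRKBS

/-! ### Integration against products of vector measures -/

section Fubini

variable {α β E F G : Type*} [MeasurableSpace α] [MeasurableSpace β]
  [NormedAddCommGroup E] [NormedSpace ℝ E] [NormedAddCommGroup F] [NormedSpace ℝ F]
  [NormedAddCommGroup G] [NormedSpace ℝ G] [CompleteSpace G]

/-- A bounded strongly measurable function is integrable for a vector measure of finite
variation. -/
theorem integrable_of_bounded {f : α → E} (hf : StronglyMeasurable f) {C : ℝ}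
    (hC : ∀ x, ‖f x‖ ≤ C) (m : Measure α) [IsFiniteMeasure m] : Integrable f m :=
  Integrable.of_bound hf.aestronglyMeasurable C (Eventually.of_forall hC)

theorem norm_integral_smul_le (ν : VectorMeasure α F) [IsFiniteMeasure ν.variation] {f : α → ℝ}
    {C : ℝ} (hC : ∀ x, ‖f x‖ ≤ C) :
    ‖∫ᵛ y, f y ∂•ν‖ ≤ C * ν.variation.real Set.univ := by
  -- A point is needed to force `0 ≤ C`; on the empty space `C` may be negative, but `ν` vanishes.
  rcases isEmpty_or_nonempty α with h | ⟨⟨a⟩⟩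
  · rw [ν.eq_zero_of_isEmpty]; simp
  have hC0 : 0 ≤ C := (norm_nonneg _).trans (hC a)
  refine (VectorMeasure.norm_integral_le_of_norm_le_const (Eventually.of_forall hC)).trans ?_
  gcongr
  exact mul_le_of_le_one_right hC0 ContinuousLinearMap.opNorm_lsmul_le

variable (ν : VectorMeasure β F) [IsFiniteMeasure ν.variation]

theorem integrable_simpleFunc_section (f : SimpleFunc (α × β) ℝ) (x : α) :
    ν.Integrable fun y => f (x, y) := by
  obtain ⟨c, hc⟩ := f.exists_forall_norm_le
  exact integrable_of_bounded (f.stronglyMeasurable.comp_measurable measurable_prodMk_left)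
    (fun y => hc (x, y)) _

variable [CompleteSpace F]

theorem integral_indicator_section {s : Set (α × β)} (hs : MeasurableSet s) (c : ℝ) (x : α) :
    ∫ᵛ y, s.indicator (fun _ => c) (x, y) ∂•ν = c • ν (Prod.mk x ⁻¹' s) := by
  have := VectorMeasure.integral_indicator_const (μ := ν) (B := ContinuousLinearMap.lsmul ℝ ℝ) c
    (measurable_prodMk_left (x := x) hs)
  simpa using! this

theorem simpleFunc_piecewise_eq_indicator {s : Set α} (hs : MeasurableSet s) (c : ℝ) (z : α) :
    (SimpleFunc.piecewise s hs (SimpleFunc.const _ c) (SimpleFunc.const _ 0)) z =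
      s.indicator (fun _ => c) z := by
  classical
  simp [SimpleFunc.piecewise_apply, Set.indicator_apply]

theorem stronglyMeasurable_integral_simpleFunc (f : SimpleFunc (α × β) ℝ) :
    StronglyMeasurable (fun x => ∫ᵛ y, f (x, y) ∂•ν) := by
  induction f using SimpleFunc.induction with
  | const c hs =>
    simp only [simpleFunc_piecewise_eq_indicator, integral_indicator_section ν hs]
    exact (VectorMeasure.stronglyMeasurable_vectorMeasure_prodMk_left hs).const_smul c
  | @add f g _ hf hg =>
    convert hf.add hg using 1
    ext x
    exact VectorMeasure.integral_fun_add (integrable_simpleFunc_section ν f x)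
      (integrable_simpleFunc_section ν g x)

variable (μ : VectorMeasure α E) [IsFiniteMeasure μ.variation] (B : E →L[ℝ] F →L[ℝ] G)

/-- For an indicator this is the formula for the product measure of a set as the integral of the
measures of its sections; linearity does the rest. The inner integral lies in `F` and `μ` in `E`,
hence `B.flip`. -/
theorem integral_prod_simpleFunc (f : SimpleFunc (α × β) ℝ) :
    ∫ᵛ z, f z ∂•(μ.prod ν B) = ∫ᵛ x, (∫ᵛ y, f (x, y) ∂•ν) ∂[B.flip; μ] := by
  induction f using SimpleFunc.induction with
  | const c hs =>
    simp only [simpleFunc_piecewise_eq_indicator, integral_indicator_section ν hs]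
    rw [VectorMeasure.integral_indicator_const c hs, VectorMeasure.integral_fun_smul,
      VectorMeasure.prod_apply_eq_integral hs]
    simp
  | @add f g _ hf hg =>
    have hi : ∀ h : SimpleFunc (α × β) ℝ, μ.Integrable fun x => ∫ᵛ y, h (x, y) ∂•ν := fun h => by
      obtain ⟨c, hc⟩ := h.exists_forall_norm_le
      exact integrable_of_bounded (stronglyMeasurable_integral_simpleFunc ν h)
        (fun x => norm_integral_smul_le ν fun y => hc (x, y)) _
    have h1 : ∀ x, ∫ᵛ y, (f + g) (x, y) ∂•ν = (∫ᵛ y, f (x, y) ∂•ν) + ∫ᵛ y, g (x, y) ∂•ν :=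
      fun x => VectorMeasure.integral_fun_add (integrable_simpleFunc_section ν f x)
        (integrable_simpleFunc_section ν g x)
    simp only [h1]
    obtain ⟨cf, hcf⟩ := f.exists_forall_norm_le
    obtain ⟨cg, hcg⟩ := g.exists_forall_norm_le
    rw [VectorMeasure.integral_fun_add (hi f) (hi g), ← hf, ← hg]
    exact VectorMeasure.integral_fun_add (integrable_of_bounded f.stronglyMeasurable hcf _)
      (integrable_of_bounded g.stronglyMeasurable hcg _)

variable {f : α × β → ℝ} (hf : StronglyMeasurable f) {C : ℝ} (hC : ∀ z, ‖f z‖ ≤ C)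
include hf hC

theorem tendsto_integral_approxBounded_section (hC0 : 0 ≤ C) (x : α) :
    Tendsto (fun n => ∫ᵛ y, hf.approxBounded C n (x, y) ∂•ν) atTop (𝓝 (∫ᵛ y, f (x, y) ∂•ν)) :=
  VectorMeasure.tendsto_integral_filter_of_norm_le_const
    (Eventually.of_forall fun n => ((hf.approxBounded C n).stronglyMeasurable.comp_measurable
      measurable_prodMk_left).aestronglyMeasurable)
    ⟨C, Eventually.of_forall fun n => Eventually.of_forall fun y =>
      hf.norm_approxBounded_le hC0 n (x, y)⟩
    (Eventually.of_forall fun y => hf.tendsto_approxBounded_of_norm_le (hC (x, y)))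

theorem stronglyMeasurable_integral_section :
    StronglyMeasurable (fun x => ∫ᵛ y, f (x, y) ∂•ν) := by
  rcases isEmpty_or_nonempty (α × β) with h | ⟨⟨a⟩⟩
  · rcases isEmpty_prod.1 h with h' | h'
    · exact StronglyMeasurable.of_subsingleton_dom
    · rw [ν.eq_zero_of_isEmpty]
      simp only [VectorMeasure.integral_zero_vectorMeasure]
      exact stronglyMeasurable_const
  have hC0 : 0 ≤ C := (norm_nonneg _).trans (hC a)
  exact stronglyMeasurable_of_tendsto atTop
    (fun n => stronglyMeasurable_integral_simpleFunc ν (hf.approxBounded C n)) (tendsto_pi_nhds.2 fun x => tendsto_integral_approxBounded_section ν hf hC hC0 x)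

/-- Fubini's theorem for products of vector measures. -/
theorem integral_prod_eq :
    ∫ᵛ z, f z ∂•(μ.prod ν B) = ∫ᵛ x, (∫ᵛ y, f (x, y) ∂•ν) ∂[B.flip; μ] := by
  rcases isEmpty_or_nonempty (α × β) with h | ⟨⟨a⟩⟩
  · rw [(μ.prod ν B).eq_zero_of_isEmpty]
    rcases isEmpty_prod.1 h with h' | h'
    · rw [μ.eq_zero_of_isEmpty]; simp
    · rw [ν.eq_zero_of_isEmpty]; simp
  have hC0 : 0 ≤ C := (norm_nonneg _).trans (hC a)
  -- Both sides are limits of their values on bounded simple approximations; constants dominate, the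
  -- inner integrals being at most `C` times the total variation of `ν`.
  have h1 : Tendsto (fun n => ∫ᵛ z, hf.approxBounded C n z ∂•(μ.prod ν B)) atTop
      (𝓝 (∫ᵛ z, f z ∂•(μ.prod ν B))) :=
    VectorMeasure.tendsto_integral_filter_of_norm_le_const
      (Eventually.of_forall fun n => (hf.approxBounded C n).stronglyMeasurable.aestronglyMeasurable)
      ⟨C, Eventually.of_forall fun n => Eventually.of_forall fun z =>
        hf.norm_approxBounded_le hC0 n z⟩
      (Eventually.of_forall fun z => hf.tendsto_approxBounded_of_norm_le (hC z))
  have h2 : Tendsto (fun n => ∫ᵛ x, (∫ᵛ y, hf.approxBounded C n (x, y) ∂•ν) ∂[B.flip; μ]) atTop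
      (𝓝 (∫ᵛ x, (∫ᵛ y, f (x, y) ∂•ν) ∂[B.flip; μ])) :=
    VectorMeasure.tendsto_integral_filter_of_norm_le_const
      (Eventually.of_forall fun n =>
        (stronglyMeasurable_integral_simpleFunc ν (hf.approxBounded C n)).aestronglyMeasurable)
      ⟨_, Eventually.of_forall fun n => Eventually.of_forall fun x =>
        norm_integral_smul_le ν fun y => hf.norm_approxBounded_le hC0 n (x, y)⟩
      (Eventually.of_forall fun x => tendsto_integral_approxBounded_section ν hf hC hC0 x)
  refine tendsto_nhds_unique h1 (h2.congr fun n => ?_)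
  exact (integral_prod_simpleFunc ν μ B _).symm

/-- Fubini's theorem for products of vector measures, integrating over the first factor first. -/
theorem integral_prod_eq_symm [CompleteSpace E] :
    ∫ᵛ z, f z ∂•(μ.prod ν B) = ∫ᵛ y, (∫ᵛ x, f (x, y) ∂•μ) ∂[B; ν] := by
  -- A product measure is determined on rectangles, so exchanging the factors reduces the claim to
  -- the other order of integration.
  have h1 : μ.prod ν B = (ν.prod μ B.flip).map MeasurableEquiv.prodComm := by
    refine VectorMeasure.prod_eq_of_forall_apply_prod fun s t hs ht => ?_
    rw [VectorMeasure.map_apply _ (MeasurableEquiv.measurable _) (hs.prod ht)]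
    simp [MeasurableEquiv.prodComm]
  rw [h1, VectorMeasure.integral_map_equiv]
  exact integral_prod_eq μ ν B.flip (f := fun z => f z.swap)
    (hf.comp_measurable measurable_swap) (fun z => hC _)

end Fubini

/-! ### Measurability of `φ` for the product σ-algebra -/

section Measurability

variable {X Ω : Type*} [TopologicalSpace X] [TopologicalSpace Ω]
  [MeasurableSpace X] [OpensMeasurableSpace X] [MeasurableSpace Ω] [OpensMeasurableSpace Ω]

/-- Functions in `C₀(X × Ω)` are measurable for the product of the Borel `σ`-algebras. -/
theorem stronglyMeasurable_zeroAtInfty_prod (φ : C₀(X × Ω, ℝ)) : StronglyMeasurable φ := by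
  -- Soft thresholding: `t n` moves values by at most `1 / (n + 1)` and kills those of modulus below
  -- that. So `t n ∘ φ` is continuous with compact support, hence measurable for the product
  -- σ-algebra even if the Borel σ-algebra of the product is larger.
  let t : ℕ → ℝ → ℝ := fun n r => r - max (-(1 / ((n : ℝ) + 1))) (min r (1 / ((n : ℝ) + 1)))
  have ht : ∀ n, Continuous (t n) := fun n => by fun_prop
  have htr : ∀ n r, |r - t n r| ≤ 1 / ((n : ℝ) + 1) := fun n r => by
    have : (0 : ℝ) < 1 / ((n : ℝ) + 1) := by positivity
    simp only [t, sub_sub_cancel]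
    exact abs_le.2 ⟨le_max_left _ _, max_le (by linarith) (min_le_right _ _)⟩
  refine stronglyMeasurable_of_tendsto (f := fun n z => t n (φ z)) atTop (fun n => ?_)
    (tendsto_pi_nhds.2 fun z => ?_)
  · have hpos : (0 : ℝ) < 1 / ((n : ℝ) + 1) := by positivity
    refine HasCompactSupport.stronglyMeasurable_of_prod ((ht n).comp φ.continuous) ?_
    have h0 : ∀ᶠ z in cocompact (X × Ω), |φ z| < 1 / ((n : ℝ) + 1) := by
      have := φ.zero_at_infty'.norm
      simp only [norm_zero] at this
      exact this.eventually (gt_mem_nhds hpos)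
    obtain ⟨K, hK, hKs⟩ := mem_cocompact.1 h0
    refine HasCompactSupport.intro' (K := {z | 1 / ((n : ℝ) + 1) ≤ |φ z|}) ?_ ?_ ?_
    · refine hK.of_isClosed_subset (isClosed_le continuous_const φ.continuous.abs) fun z hz => ?_
      by_contra hzK
      exact absurd (show |φ z| < _ from hKs hzK) (not_lt.2 hz)
    · exact isClosed_le continuous_const φ.continuous.abs
    · intro z hz
      have hz' := abs_lt.1 (not_le.1 (show ¬ _ ≤ |φ z| from hz))
      simp only [t, min_eq_left hz'.2.le, max_eq_right hz'.1.le, sub_self]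
  · rw [tendsto_iff_norm_sub_tendsto_zero]
    refine squeeze_zero (fun _ => norm_nonneg _) (fun n => ?_) tendsto_one_div_add_atTop_nhds_zero_nat
    rw [norm_sub_rev]
    exact htr n (φ z)

end Measurability

/-! ### Absolutely convergent series of vector measures -/

section Series

variable {Ω E : Type*} [MeasurableSpace Ω] [NormedAddCommGroup E]

/-- The triangle inequality bounds the norm of `ν s` on each measurable set by the sum of
variations, and the variation is the least measure with such a bound. -/
theorem variation_le_sum_of_hasSum {μ : ℕ → VectorMeasure Ω E} {ν : VectorMeasure Ω E}
    (h : ∀ s, HasSum (fun k => μ k s) (ν s)) :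
    ν.variation ≤ Measure.sum fun k => (μ k).variation := by
  refine VectorMeasure.variation_le_of_forall_enorm_le fun s hs => ?_
  rw [← (h s).tsum_eq, Measure.sum_apply _ hs]
  exact enorm_tsum_le_tsum_enorm.trans
    (ENNReal.tsum_le_tsum fun k => VectorMeasure.enorm_measure_le_variation _ _)

theorem isFiniteMeasure_sum_of_summable {m : ℕ → Measure Ω} [∀ k, IsFiniteMeasure (m k)]
    (h : Summable fun k => (m k).real Set.univ) : IsFiniteMeasure (Measure.sum m) := by
  refine ⟨?_⟩
  rw [Measure.sum_apply _ MeasurableSet.univ]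
  have := h.tsum_ofReal_lt_top
  simpa using this

theorem measureReal_univ_mono {m n : Measure Ω} [IsFiniteMeasure n] (h : m ≤ n) :
    m.real Set.univ ≤ n.real Set.univ :=
  ENNReal.toReal_mono (measure_ne_top _ _) (h _)

theorem measureReal_sum_univ {m : ℕ → Measure Ω} [∀ k, IsFiniteMeasure (m k)] :
    (Measure.sum m).real Set.univ = ∑' k, (m k).real Set.univ := by
  rw [measureReal_def, Measure.sum_apply _ MeasurableSet.univ,
    ENNReal.tsum_toReal_eq fun k => measure_ne_top _ _]
  rfl

variable [CompleteSpace E]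

/-- A series of vector measures with summable total variations converges to a vector measure. -/
theorem exists_vectorMeasure_hasSum {μ : ℕ → VectorMeasure Ω E}
    [∀ k, IsFiniteMeasure (μ k).variation]
    (h : Summable fun k => (μ k).variation.real Set.univ) :
    ∃ ν : VectorMeasure Ω E, ∀ s, HasSum (fun k => μ k s) (ν s) := by
  have hs : ∀ s, Summable fun k => μ k s := fun s =>
    Summable.of_norm_bounded h fun k =>
      (VectorMeasure.norm_measure_le_variation (measure_ne_top _ _)).trans
        (measureReal_mono (Set.subset_univ s))
  refine ⟨⟨fun s => ∑' k, μ k s, by simp, fun s hs => by simp [VectorMeasure.not_measurable _ hs],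
    fun f hf hd => ?_⟩, fun s => (hs s).hasSum⟩
  have hfib : ∀ k, HasSum (fun i => (μ k).variation.real (f i))
      ((μ k).variation.real (⋃ i, f i)) := fun k => by
    have h1 := measure_iUnion (μ := (μ k).variation) hd hf
    rw [measureReal_def, h1, ENNReal.tsum_toReal_eq fun i => measure_ne_top _ _]
    exact (ENNReal.summable_toReal (by rw [← h1]; exact measure_ne_top _ _)).hasSum
  -- Countable additivity is an exchange of two sums. It is allowed because, for fixed `k`, the
  -- variations of the `f i` add up to at most the total variation of `μ k`.
  have hsum : Summable fun p : ℕ × ℕ => μ p.1 (f p.2) := by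
    refine Summable.of_norm_bounded (g := fun p : ℕ × ℕ => (μ p.1).variation.real (f p.2)) ?_
      fun p => VectorMeasure.norm_measure_le_variation (measure_ne_top _ _)
    refine (summable_prod_of_nonneg fun p => measureReal_nonneg).2 ⟨fun k => (hfib k).summable, ?_⟩
    simp only [(hfib _).tsum_eq]
    exact Summable.of_nonneg_of_le (fun k => measureReal_nonneg)
      (fun k => measureReal_mono (Set.subset_univ _)) h
  have h1 : HasSum (fun k => μ k (⋃ i, f i)) (∑' p : ℕ × ℕ, μ p.1 (f p.2)) :=
    hsum.hasSum.prod_fiberwise fun k => (μ k).m_iUnion hf hd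
  have h2 : HasSum (fun i => ∑' k, μ k (f i)) (∑' p : ℕ × ℕ, μ p.1 (f p.2)) :=
    ((Equiv.prodComm ℕ ℕ).hasSum_iff.2 hsum.hasSum).prod_fiberwise fun i => (hs (f i)).hasSum
  rw [h1.tsum_eq]
  exact h2

end Series

/-! ### The space of regular measures -/

section RegularMeasures

variable {Ω E : Type*} [TopologicalSpace Ω] [T2Space Ω] [MeasurableSpace Ω] [BorelSpace Ω]
  [NormedAddCommGroup E] [NormedSpace ℝ E]

instance isFiniteMeasure_variation (μ : regularMeasures Ω E) :
    IsFiniteMeasure (μ : VectorMeasure Ω E).variation := μ.2.1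

/-- The total variation norm. -/
noncomputable def totalVariation (μ : regularMeasures Ω E) : ℝ :=
  (μ : VectorMeasure Ω E).variation.real Set.univ

theorem totalVariation_nonneg (μ : regularMeasures Ω E) : 0 ≤ totalVariation μ :=
  measureReal_nonneg

theorem totalVariation_add_le (μ ν : regularMeasures Ω E) :
    totalVariation (μ + ν) ≤ totalVariation μ + totalVariation ν := by
  refine (measureReal_univ_mono VectorMeasure.variation_add_le).trans ?_
  rw [measureReal_add_apply]
  rfl

theorem totalVariation_neg (μ : regularMeasures Ω E) : totalVariation (-μ) = totalVariation μ := by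
  simp [totalVariation, VectorMeasure.variation_neg]

theorem totalVariation_smul (c : ℝ) (μ : regularMeasures Ω E) :
    totalVariation (c • μ) = |c| * totalVariation μ := by
  simp [totalVariation, VectorMeasure.variation_smul, measureReal_def]

/-- The space of regular measures is complete. -/
theorem exists_tendsto_totalVariation [CompleteSpace E] {μ : ℕ → regularMeasures Ω E}
    (h : Summable fun k => totalVariation (μ k)) :
    ∃ ν, Tendsto (fun n => totalVariation (ν - ∑ k ∈ Finset.range n, μ k)) atTop (𝓝 0) := by
  obtain ⟨ν, hν⟩ := exists_vectorMeasure_hasSum (μ := fun k => (μ k : VectorMeasure Ω E)) h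
  have hfin := isFiniteMeasure_sum_of_summable
    (m := fun k => (μ k : VectorMeasure Ω E).variation) h
  have hle := variation_le_sum_of_hasSum hν
  have : ∀ k, (μ k : VectorMeasure Ω E).variation.Regular := fun k => (μ k).2.2
  -- The limit inherits regularity from this dominating measure through `regular_of_le`.
  have hreg : (Measure.sum fun k => (μ k : VectorMeasure Ω E).variation).Regular := inferInstance
  refine ⟨⟨ν, isFiniteMeasure_of_le _ hle, regular_of_le hreg hle⟩, ?_⟩
  refine squeeze_zero (fun n => totalVariation_nonneg _) (fun n => ?_)
    (tendsto_sum_nat_add fun k => totalVariation (μ k))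
  have hn : Summable fun k => totalVariation (μ (k + n)) :=
    (summable_nat_add_iff (f := fun k => totalVariation (μ k)) n).2 h
  have hfin' := isFiniteMeasure_sum_of_summable
    (m := fun k => (μ (k + n) : VectorMeasure Ω E).variation) hn
  -- The remainder is itself the sum of the tail series, so its total variation is at most the tail
  -- of a convergent series.
  have htail : (ν - ∑ k ∈ Finset.range n, (μ k : VectorMeasure Ω E)).variation ≤
      Measure.sum fun k => (μ (k + n) : VectorMeasure Ω E).variation := by
    refine variation_le_sum_of_hasSum fun s => ?_
    have hsum : (ν - ∑ k ∈ Finset.range n, (μ k : VectorMeasure Ω E)) s =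
        ν s - ∑ k ∈ Finset.range n, (μ k : VectorMeasure Ω E) s := by
      simp
    rw [hsum]
    exact (hasSum_nat_add_iff' n).2 (hν s)
  have h1 := measureReal_univ_mono htail
  rw [measureReal_sum_univ] at h1
  have h2 : ((⟨ν, isFiniteMeasure_of_le _ hle, regular_of_le hreg hle⟩ -
      ∑ k ∈ Finset.range n, μ k : regularMeasures Ω E) : VectorMeasure Ω E) =
      ν - ∑ k ∈ Finset.range n, (μ k : VectorMeasure Ω E) := by
    rw [Submodule.coe_sub, Submodule.coe_sum]
  rw [totalVariation, h2]
  exact h1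

/-- The Dirac measure with mass `v` at `w`. -/
noncomputable def regularDirac (w : Ω) (v : E) : regularMeasures Ω E :=
  ⟨VectorMeasure.dirac w v, inferInstance, by
    have : (Measure.dirac w).InnerRegularCompactLTTop := by
      refine ⟨fun s hs r hr => ?_⟩
      by_cases hw : w ∈ s
      · refine ⟨{w}, by simpa using hw, isCompact_singleton, ?_⟩
        simpa [hw] using hr
      · simp [Measure.dirac_apply' w hs.1, hw] at hr
    have : (Measure.dirac w).Regular := inferInstance
    rw [VectorMeasure.variation_dirac]
    exact Measure.Regular.smul enorm_ne_top⟩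

end RegularMeasures

/-! ### The norm of the integral vv-RKBS -/

section IntegralNorm

/-- A norm for which absolutely convergent series converge is complete. -/
theorem exists_tendsto_of_summable_imp {V : Type*} [AddCommGroup V] (N : AddGroupNorm V)
    (h : ∀ u : ℕ → V, (Summable fun k => N (u k)) →
      ∃ a, Tendsto (fun n => N (∑ k ∈ Finset.range n, u k - a)) atTop (𝓝 0))
    (s : ℕ → V) (hs : ∀ ε > 0, ∃ n₀, ∀ m ≥ n₀, ∀ n ≥ n₀, N (s m - s n) < ε) :
    ∃ a, Tendsto (fun n => N (s n - a)) atTop (𝓝 0) := by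
  -- The abstract `V` has no topology of its own to clash with that of `N`, unlike a space of
  -- functions.
  let _ := N.toNormedAddCommGroup
  have hc : CompleteSpace V :=
    NormedAddCommGroup.completeSpace_of_summable_imp_tendsto fun u hu => by
      obtain ⟨a, ha⟩ := h u hu
      exact ⟨a, tendsto_iff_norm_sub_tendsto_zero.2 ha⟩
  have hC : CauchySeq s := by
    refine Metric.cauchySeq_iff.2 fun ε hε => ?_
    obtain ⟨n₀, hn₀⟩ := hs ε hε
    exact ⟨n₀, fun m hm n hn => by rw [dist_eq_norm]; exact hn₀ m hm n hn⟩
  obtain ⟨a, ha⟩ := cauchySeq_tendsto_of_complete hC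
  exact ⟨a, tendsto_iff_norm_sub_tendsto_zero.1 ha⟩

variable {X Ω E : Type*} [TopologicalSpace X] [TopologicalSpace Ω] [T2Space Ω]
  [MeasurableSpace Ω] [BorelSpace Ω] [NormedAddCommGroup E] [NormedSpace ℝ E]
  (φ : C₀(X × Ω, ℝ))

theorem norm_integralOperator_le (μ : regularMeasures Ω E) (x : X) :
    ‖integralOperator E φ μ x‖ ≤ ‖φ.toBCF‖ * totalVariation μ :=
  norm_integral_smul_le _ fun w => φ.toBCF.norm_coe_le_norm (x, w)

theorem integralNorm_nonneg (f : integralSpace E φ) : 0 ≤ integralNorm E φ f :=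
  Real.sInf_nonneg (by rintro r ⟨μ, -, rfl⟩; exact measureReal_nonneg)

variable {φ}

theorem integralNorm_le {f : integralSpace E φ} {μ : regularMeasures Ω E}
    (h : integralOperator E φ μ = f) : integralNorm E φ f ≤ totalVariation μ :=
  csInf_le ⟨0, by rintro r ⟨μ, -, rfl⟩; exact measureReal_nonneg⟩ ⟨μ, h, rfl⟩

theorem exists_totalVariation_lt (f : integralSpace E φ) {ε : ℝ} (hε : 0 < ε) :
    ∃ μ : regularMeasures Ω E, integralOperator E φ μ = f ∧
      totalVariation μ < integralNorm E φ f + ε := by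
  obtain ⟨μ, hμ⟩ := f.2
  obtain ⟨r, ⟨ν, hν, rfl⟩, hr⟩ := exists_lt_of_csInf_lt (s := {r | ∃ μ : regularMeasures Ω E,
    integralOperator E φ μ = f ∧ r = (μ : VectorMeasure Ω E).variation.real Set.univ})
    ⟨_, μ, hμ, rfl⟩ (lt_add_of_pos_right (integralNorm E φ f) hε)
  exact ⟨ν, hν, hr⟩

/-- A bound by a multiple of the total variation of all representing measures is a bound by the
norm of the integral space. -/
theorem le_mul_integralNorm {f : integralSpace E φ} {a C : ℝ}
    (h : ∀ μ : regularMeasures Ω E, integralOperator E φ μ = f → a ≤ C * totalVariation μ)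
    (hC : 0 ≤ C) : a ≤ C * integralNorm E φ f := by
  refine le_of_forall_pos_le_add fun ε hε => ?_
  -- The denominator is `C + 1` because `C` may be zero.
  obtain ⟨μ, hμ, hlt⟩ := exists_totalVariation_lt f (ε := ε / (C + 1)) (by positivity)
  calc a ≤ C * totalVariation μ := h μ hμ
    _ ≤ C * (integralNorm E φ f + ε / (C + 1)) := by gcongr
    _ = C * integralNorm E φ f + C / (C + 1) * ε := by ring
    _ ≤ C * integralNorm E φ f + 1 * ε := by
      gcongr
      exact (div_le_one (by positivity)).2 (by linarith)
    _ = C * integralNorm E φ f + ε := by ring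

theorem norm_apply_le_integralNorm (f : integralSpace E φ) (x : X) :
    ‖(f : X → E) x‖ ≤ ‖φ.toBCF‖ * integralNorm E φ f :=
  le_mul_integralNorm (fun μ hμ => by rw [← hμ]; exact norm_integralOperator_le φ μ x)
    (norm_nonneg _)

theorem integralNorm_zero : integralNorm E φ 0 = 0 :=
  le_antisymm ((integralNorm_le (μ := 0) (by simp)).trans (by simp [totalVariation]))
    (integralNorm_nonneg φ 0)

theorem integralNorm_add_le (f g : integralSpace E φ) :
    integralNorm E φ (f + g) ≤ integralNorm E φ f + integralNorm E φ g := by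
  refine le_of_forall_pos_le_add fun ε hε => ?_
  obtain ⟨μ, hμ, hμ'⟩ := exists_totalVariation_lt f (half_pos hε)
  obtain ⟨ν, hν, hν'⟩ := exists_totalVariation_lt g (half_pos hε)
  have := integralNorm_le (f := f + g) (μ := μ + ν) (by rw [map_add, hμ, hν]; rfl)
  linarith [totalVariation_add_le μ ν]

theorem integralNorm_smul_le (c : ℝ) (f : integralSpace E φ) :
    integralNorm E φ (c • f) ≤ |c| * integralNorm E φ f := by
  refine le_mul_integralNorm (fun μ hμ => ?_) (abs_nonneg c)
  rw [← totalVariation_smul]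
  exact integralNorm_le (by rw [map_smul, hμ]; rfl)

theorem integralNorm_smul (c : ℝ) (f : integralSpace E φ) :
    integralNorm E φ (c • f) = |c| * integralNorm E φ f := by
  refine le_antisymm (integralNorm_smul_le c f) ?_
  rcases eq_or_ne c 0 with rfl | hc
  · simpa using integralNorm_nonneg φ _
  have h := integralNorm_smul_le c⁻¹ (c • f)
  rw [smul_smul, inv_mul_cancel₀ hc, one_smul, abs_inv] at h
  rwa [← le_inv_mul_iff₀ (abs_pos.2 hc)]

theorem isNormedFunctionSpace_integralSpace :
    IsNormedFunctionSpace (integralSpace E φ) (integralNorm E φ) where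
  nonneg := integralNorm_nonneg φ
  eq_zero_iff f := by
    refine ⟨fun h => ?_, fun h => h ▸ integralNorm_zero⟩
    ext x
    have := norm_apply_le_integralNorm f x
    rw [h, mul_zero] at this
    simpa using this
  smul := integralNorm_smul
  add_le := integralNorm_add_le
  eval_bounded x := ⟨_, norm_nonneg _, fun f => norm_apply_le_integralNorm f x⟩

/-- The integral space is a vv-RKBS. -/
theorem isVVRKBS_integralSpace [CompleteSpace E] :
    IsVVRKBS (integralSpace E φ) (integralNorm E φ) where
  toIsNormedFunctionSpace := isNormedFunctionSpace_integralSpace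
  complete := by
    have hN := isNormedFunctionSpace_integralSpace (E := E) (φ := φ)
    refine exists_tendsto_of_summable_imp (V := integralSpace E φ)
      { toFun := integralNorm E φ
        map_zero' := integralNorm_zero
        add_le' := integralNorm_add_le
        neg' := fun f => by
          have := integralNorm_smul (-1) f
          rwa [show (-1 : ℝ) • f = -f from neg_one_smul ℝ f, abs_neg, abs_one, one_mul] at this
        eq_zero_of_map_eq_zero' := fun f => (hN.eq_zero_iff f).1 } fun u hu => ?_
    -- The quotient argument: lifts optimal up to the summable slack `(1 / 2) ^ k` form an
    -- absolutely convergent series of measures, whose sum is mapped to the required limit.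
    have hpos : ∀ k : ℕ, (0 : ℝ) < (1 / 2) ^ k := fun k => by positivity
    choose μ hμ hlt using fun k => exists_totalVariation_lt (u k) (hpos k)
    obtain ⟨ν, hν⟩ := exists_tendsto_totalVariation (μ := μ)
      (Summable.of_nonneg_of_le (fun k => totalVariation_nonneg _) (fun k => (hlt k).le)
        (hu.add summable_geometric_two))
    refine ⟨⟨integralOperator E φ ν, ν, rfl⟩, squeeze_zero (fun n => integralNorm_nonneg φ _)
      (fun n => ?_) hν⟩
    have h1 := integralNorm_le (μ := ∑ k ∈ Finset.range n, μ k - ν)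
      (f := ∑ k ∈ Finset.range n, u k - ⟨integralOperator E φ ν, ν, rfl⟩) (by
        simp [map_sub, map_sum, hμ])
    refine h1.trans_eq ?_
    rw [← totalVariation_neg, neg_sub]

end IntegralNorm

/-! ### The supremum norm -/

section SupNorm

variable {Ω Ud : Type*} [NormedAddCommGroup Ud] [NormedSpace ℝ Ud] {B : Submodule ℝ (Ω → Ud)}

theorem supNorm_nonneg (g : B) : 0 ≤ supNorm B g := Real.iSup_nonneg fun _ => norm_nonneg _

theorem supNorm_le {g : B} {a : ℝ} (ha : 0 ≤ a) (h : ∀ w, ‖(g : Ω → Ud) w‖ ≤ a) :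
    supNorm B g ≤ a := Real.iSup_le h ha

/-- All functions in `B` are bounded. -/
def IsBoundedSpace (B : Submodule ℝ (Ω → Ud)) : Prop := ∀ g ∈ B, ∃ C, ∀ w, ‖g w‖ ≤ C

/-- Boundedness is essential: the real supremum of an unbounded family is 0 by convention. -/
theorem IsBoundedSpace.norm_le_supNorm (hB : IsBoundedSpace B) (g : B) (w : Ω) :
    ‖(g : Ω → Ud) w‖ ≤ supNorm B g := by
  obtain ⟨C, hC⟩ := hB g g.2
  exact le_ciSup (f := fun w => ‖(g : Ω → Ud) w‖) ⟨C, by rintro _ ⟨w, rfl⟩; exact hC w⟩ w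

theorem IsBoundedSpace.isNormedFunctionSpace (hB : IsBoundedSpace B) :
    IsNormedFunctionSpace B (supNorm B) where
  nonneg := supNorm_nonneg
  eq_zero_iff g := by
    refine ⟨fun h => ?_, ?_⟩
    · ext w
      simpa [h] using hB.norm_le_supNorm g w
    · rintro rfl
      simp [supNorm]
  smul c g := by
    simp [supNorm, norm_smul, Real.mul_iSup_of_nonneg (abs_nonneg c)]
  add_le f g := supNorm_le (add_nonneg (supNorm_nonneg f) (supNorm_nonneg g)) fun w =>
    (norm_add_le _ _).trans (add_le_add (hB.norm_le_supNorm f w) (hB.norm_le_supNorm g w))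
  eval_bounded w := ⟨1, zero_le_one, fun g => by simpa using hB.norm_le_supNorm g w⟩

theorem IsBoundedSpace.uniformClosure (hB : IsBoundedSpace B) :
    IsBoundedSpace (uniformClosure B) := by
  intro g hg
  obtain ⟨h, hh, hgh⟩ := hg 1 one_pos
  obtain ⟨C, hC⟩ := hB h hh
  refine ⟨C + 1, fun w => ?_⟩
  calc ‖g w‖ = ‖h w + (g w - h w)‖ := by rw [add_sub_cancel]
    _ ≤ C + 1 := (norm_add_le _ _).trans (add_le_add (hC w) (hgh w))

/-- A Cauchy sequence has pointwise limits by completeness of `Ud`; the convergence is uniform, and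
an ε/2 argument puts the limit back in the closure. -/
theorem IsBoundedSpace.isVVRKBS_uniformClosure [CompleteSpace Ud] (hB : IsBoundedSpace B) :
    IsVVRKBS (VVRKBS.uniformClosure B) (supNorm (VVRKBS.uniformClosure B)) where
  toIsNormedFunctionSpace := hB.uniformClosure.isNormedFunctionSpace
  complete := by
    intro s hs
    have hpt : ∀ ε > 0, ∃ n₀, ∀ m ≥ n₀, ∀ n ≥ n₀, ∀ w,
        ‖(s m : Ω → Ud) w - (s n : Ω → Ud) w‖ < ε := fun ε hε => by
      obtain ⟨n₀, hn₀⟩ := hs ε hε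
      exact ⟨n₀, fun m hm n hn w =>
        (hB.uniformClosure.norm_le_supNorm (s m - s n) w).trans_lt (hn₀ m hm n hn)⟩
    have hc : ∀ w, ∃ l, Tendsto (fun n => (s n : Ω → Ud) w) atTop (𝓝 l) := fun w => by
      refine cauchySeq_tendsto_of_complete (Metric.cauchySeq_iff.2 fun ε hε => ?_)
      obtain ⟨n₀, hn₀⟩ := hpt ε hε
      exact ⟨n₀, fun m hm n hn => by rw [dist_eq_norm]; exact hn₀ m hm n hn w⟩
    choose l hl using hc
    have hle : ∀ ε > 0, ∃ n₀, ∀ n ≥ n₀, ∀ w, ‖(s n : Ω → Ud) w - l w‖ ≤ ε := fun ε hε => by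
      obtain ⟨n₀, hn₀⟩ := hpt ε hε
      exact ⟨n₀, fun n hn w => le_of_tendsto (tendsto_const_nhds.sub (hl w)).norm
        (eventually_atTop.2 ⟨n₀, fun m hm => (hn₀ n hn m hm w).le⟩)⟩
    have hmem : l ∈ VVRKBS.uniformClosure B := fun ε hε => by
      obtain ⟨n₀, hn₀⟩ := hle (ε / 2) (half_pos hε)
      obtain ⟨h, hh, hsh⟩ := (s n₀).2 (ε / 2) (half_pos hε)
      refine ⟨h, hh, fun w => ?_⟩
      calc ‖l w - h w‖ = ‖((s n₀ : Ω → Ud) w - h w) - ((s n₀ : Ω → Ud) w - l w)‖ := by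
            congr 1; abel
        _ ≤ ε := (norm_sub_le _ _).trans (by linarith [hsh w, hn₀ n₀ le_rfl w])
    refine ⟨⟨l, hmem⟩, Metric.tendsto_atTop.2 fun ε hε => ?_⟩
    obtain ⟨n₀, hn₀⟩ := hle (ε / 2) (half_pos hε)
    refine ⟨n₀, fun n hn => ?_⟩
    rw [Real.dist_0_eq_abs, abs_of_nonneg (supNorm_nonneg _)]
    exact (supNorm_le (half_pos hε).le fun w => hn₀ n hn w).trans_lt (half_lt_self hε)

/-- A function in the uniform closure of `B` is the uniform limit of a sequence in `B`. -/
theorem exists_seq_of_mem_uniformClosure {g : Ω → Ud} (hg : g ∈ uniformClosure B) :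
    ∃ h : ℕ → Ω → Ud, (∀ n, h n ∈ B) ∧ ∀ n w, ‖g w - h n w‖ ≤ 1 / ((n : ℝ) + 1) := by
  choose h hh hgh using fun n : ℕ => hg (1 / ((n : ℝ) + 1)) (by positivity)
  exact ⟨h, hh, hgh⟩

theorem tendsto_of_norm_sub_le_one_div {g : Ω → Ud} {h : ℕ → Ω → Ud}
    (hgh : ∀ n w, ‖g w - h n w‖ ≤ 1 / ((n : ℝ) + 1)) (w : Ω) :
    Tendsto (fun n => h n w) atTop (𝓝 (g w)) := by
  rw [tendsto_iff_norm_sub_tendsto_zero]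
  refine squeeze_zero (fun _ => norm_nonneg _) (fun n => ?_) tendsto_one_div_add_atTop_nhds_zero_nat
  rw [norm_sub_rev]
  exact hgh n w

theorem stronglyMeasurable_of_mem_uniformClosure [MeasurableSpace Ω]
    (hB : ∀ g ∈ B, StronglyMeasurable g) {g : Ω → Ud} (hg : g ∈ uniformClosure B) :
    StronglyMeasurable g := by
  obtain ⟨h, hh, hgh⟩ := exists_seq_of_mem_uniformClosure hg
  exact stronglyMeasurable_of_tendsto atTop (fun n => hB _ (hh n))
    (tendsto_pi_nhds.2 (tendsto_of_norm_sub_le_one_div hgh))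

end SupNorm

/-! ### The pairing of the integral spaces -/

section Pairing

variable {X Ω U Ud : Type*}
  [TopologicalSpace X] [T2Space X] [MeasurableSpace X] [BorelSpace X]
  [TopologicalSpace Ω] [T2Space Ω] [MeasurableSpace Ω] [BorelSpace Ω]
  [NormedAddCommGroup U] [NormedSpace ℝ U] [NormedAddCommGroup Ud] [NormedSpace ℝ Ud]

theorem isBoundedSpace_integralSpace (φ : C₀(X × Ω, ℝ)) : IsBoundedSpace (integralSpace U φ) := by
  rintro _ ⟨μ, rfl⟩
  exact ⟨_, norm_integralOperator_le φ μ⟩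

variable [CompleteSpace U] [CompleteSpace Ud]

theorem stronglyMeasurable_integralOperator (φ : C₀(X × Ω, ℝ)) (μ : regularMeasures Ω U) :
    StronglyMeasurable (integralOperator U φ μ) :=
  stronglyMeasurable_integral_section (μ : VectorMeasure Ω U)
    (stronglyMeasurable_zeroAtInfty_prod φ) fun z => φ.toBCF.norm_coe_le_norm z

theorem integralOperator_regularDirac (φ : C₀(X × Ω, ℝ)) (w : Ω) (u : U) :
    integralOperator U φ (regularDirac w u) = fun x => φ (x, w) • u := by
  ext x
  exact VectorMeasure.integral_dirac

variable (P : Ud →L[ℝ] U →L[ℝ] ℝ) (φ : C₀(X × Ω, ℝ))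

theorem integral_prod_eq_integral_integralOperator (ρ : regularMeasures X Ud)
    (μ : regularMeasures Ω U) :
    ∫ᵛ z, φ z ∂•((ρ : VectorMeasure X Ud).prod (μ : VectorMeasure Ω U) P) =
      ∫ᵛ x, integralOperator U φ μ x ∂[P.flip; (ρ : VectorMeasure X Ud)] :=
  integral_prod_eq _ _ P (stronglyMeasurable_zeroAtInfty_prod φ)
    fun z => φ.toBCF.norm_coe_le_norm z

theorem integral_prod_eq_integral_integralOperator_swap (ρ : regularMeasures X Ud)
    (μ : regularMeasures Ω U) :
    ∫ᵛ z, φ z ∂•((ρ : VectorMeasure X Ud).prod (μ : VectorMeasure Ω U) P) =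
      ∫ᵛ w, integralOperator Ud (swap φ) ρ w ∂[P; (μ : VectorMeasure Ω U)] :=
  integral_prod_eq_symm _ _ P (stronglyMeasurable_zeroAtInfty_prod φ)
    fun z => φ.toBCF.norm_coe_le_norm z

/-- The uniform closure of `{A^⋄ ρ}`. -/
noncomputable abbrev adjointSpace (Ud : Type*) [NormedAddCommGroup Ud] [NormedSpace ℝ Ud]
    (φ : C₀(X × Ω, ℝ)) : Submodule ℝ (Ω → Ud) :=
  uniformClosure (integralSpace Ud (swap φ))

variable {φ}

theorem stronglyMeasurable_adjointSpace (g : adjointSpace Ud φ) :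
    StronglyMeasurable (g : Ω → Ud) :=
  stronglyMeasurable_of_mem_uniformClosure
    (by rintro _ ⟨ρ, rfl⟩; exact stronglyMeasurable_integralOperator _ ρ) g.2

theorem norm_apply_le_supNorm (g : adjointSpace Ud φ) (w : Ω) :
    ‖(g : Ω → Ud) w‖ ≤ supNorm _ g :=
  (isBoundedSpace_integralSpace (swap φ)).uniformClosure.norm_le_supNorm g w

theorem integrable_adjointSpace (g : adjointSpace Ud φ) (m : Measure Ω) [IsFiniteMeasure m] :
    Integrable (g : Ω → Ud) m :=
  integrable_of_bounded (stronglyMeasurable_adjointSpace g) (norm_apply_le_supNorm g) m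

/-- Integrals of functions in the adjoint space depend only on `A μ`. -/
theorem integral_eq_of_integralOperator_eq (g : adjointSpace Ud φ) {μ ν : regularMeasures Ω U}
    (h : integralOperator U φ μ = integralOperator U φ ν) :
    ∫ᵛ w, (g : Ω → Ud) w ∂[P; (μ : VectorMeasure Ω U)] =
      ∫ᵛ w, (g : Ω → Ud) w ∂[P; (ν : VectorMeasure Ω U)] := by
  obtain ⟨k, hk, hgk⟩ := exists_seq_of_mem_uniformClosure g.2
  have hbd : ∀ n w, ‖k n w‖ ≤ supNorm _ g + 1 := fun n w => by
    have h1 : (1 : ℝ) / ((n : ℝ) + 1) ≤ 1 :=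
      (div_le_one (by positivity)).2 (by linarith [(n.cast_nonneg : (0 : ℝ) ≤ n)])
    calc ‖k n w‖ = ‖(g : Ω → Ud) w - ((g : Ω → Ud) w - k n w)‖ := by rw [sub_sub_cancel]
      _ ≤ _ := (norm_sub_le _ _).trans
        (add_le_add (norm_apply_le_supNorm g w) ((hgk n w).trans h1))
  have hlim : ∀ μ : regularMeasures Ω U,
      Tendsto (fun n => ∫ᵛ w, k n w ∂[P; (μ : VectorMeasure Ω U)]) atTop
        (𝓝 (∫ᵛ w, (g : Ω → Ud) w ∂[P; (μ : VectorMeasure Ω U)])) := fun μ =>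
    VectorMeasure.tendsto_integral_filter_of_norm_le_const
      (Eventually.of_forall fun n => (stronglyMeasurable_adjointSpace (φ := φ)
        ⟨k n, le_uniformClosure _ (hk n)⟩).aestronglyMeasurable)
      ⟨_, Eventually.of_forall fun n => Eventually.of_forall (hbd n)⟩
      (Eventually.of_forall (tendsto_of_norm_sub_le_one_div hgk))
  refine tendsto_nhds_unique (hlim μ) ((hlim ν).congr fun n => ?_)
  obtain ⟨ρ, hρ⟩ := hk n
  -- Fubini twice: the integral of A^⋄ρ against `μ` becomes that of Aμ against `ρ`, where `h`
  -- applies.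
  rw [← hρ, ← integral_prod_eq_integral_integralOperator_swap,
    ← integral_prod_eq_integral_integralOperator_swap,
    integral_prod_eq_integral_integralOperator, integral_prod_eq_integral_integralOperator, h]

variable (φ)

/-- The pairing `⟨g, A μ⟩ = ∫ ⟨g(w), dμ(w)⟩`. -/
noncomputable def integralPairing : adjointSpace Ud φ →ₗ[ℝ] integralSpace U φ →ₗ[ℝ] ℝ :=
  LinearMap.mk₂ ℝ (fun g f => ∫ᵛ w, (g : Ω → Ud) w ∂[P; (f.2.choose : VectorMeasure Ω U)])
    (fun g g' f => VectorMeasure.integral_add (integrable_adjointSpace g _)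
      (integrable_adjointSpace g' _))
    (fun c g f => VectorMeasure.integral_smul _ _ P c)
    -- The chosen representatives are not additive in `f`; only their images under A are, which
    -- suffices for the integral.
    (fun g f f' => by
      rw [← VectorMeasure.integral_add_vectorMeasure (integrable_adjointSpace g _)
        (integrable_adjointSpace g _)]
      refine integral_eq_of_integralOperator_eq P g
        (ν := f.2.choose + f'.2.choose) ?_
      rw [map_add, f.2.choose_spec, f'.2.choose_spec, (f + f').2.choose_spec]
      rfl)
    (fun c g f => by
      rw [← VectorMeasure.integral_smul_vectorMeasure]
      refine integral_eq_of_integralOperator_eq P g (ν := c • f.2.choose) ?_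
      rw [map_smul, f.2.choose_spec, (c • f).2.choose_spec]
      rfl)

variable {φ}

/-- Frees the pairing from the choice of representative in its definition. -/
theorem integralPairing_apply (g : adjointSpace Ud φ) {f : integralSpace U φ}
    {μ : regularMeasures Ω U} (h : integralOperator U φ μ = f) :
    integralPairing P φ g f = ∫ᵛ w, (g : Ω → Ud) w ∂[P; (μ : VectorMeasure Ω U)] :=
  integral_eq_of_integralOperator_eq P g (f.2.choose_spec.trans h.symm)

theorem integralPairing_eq_integral_prod {ρ : regularMeasures X Ud} {μ : regularMeasures Ω U}
    {g : adjointSpace Ud φ} {f : integralSpace U φ} (hg : integralOperator Ud (swap φ) ρ = g)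
    (hf : integralOperator U φ μ = f) :
    integralPairing P φ g f =
      ∫ᵛ z, φ z ∂•((ρ : VectorMeasure X Ud).prod (μ : VectorMeasure Ω U) P) := by
  rw [integralPairing_apply P g hf, integral_prod_eq_integral_integralOperator_swap, hg]

theorem abs_integralPairing_le (g : adjointSpace Ud φ) (f : integralSpace U φ) :
    |integralPairing P φ g f| ≤ ‖P‖ * supNorm _ g * integralNorm U φ f := by
  refine le_mul_integralNorm (fun μ hμ => ?_) (mul_nonneg P.opNorm_nonneg (supNorm_nonneg g))
  rw [integralPairing_apply P g hμ, mul_comm ‖P‖]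
  exact VectorMeasure.norm_integral_le_of_norm_le_const (μ := (μ : VectorMeasure Ω U)) (B := P)
    (Eventually.of_forall (norm_apply_le_supNorm g))

/-- The pairing is bounded by every bound of the pairing of the output spaces. -/
theorem abs_integralPairing_le_of_bound {C : ℝ} (hC : ∀ ud u, |P ud u| ≤ C * ‖ud‖ * ‖u‖)
    (g : adjointSpace Ud φ) (f : integralSpace U φ) :
    |integralPairing P φ g f| ≤ C * supNorm _ g * integralNorm U φ f := by
  -- An admissible `C` can be negative when `U` or `Ud` is trivial, but then this product is zero.
  -- Otherwise nonzero vectors force `0 ≤ C`, and `‖P‖ ≤ C` follows.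
  by_cases h0 : supNorm _ g * integralNorm U φ f = 0
  · have := abs_integralPairing_le P g f
    rwa [mul_assoc, h0, mul_zero] at this ⊢
  have hpos : 0 < supNorm _ g * integralNorm U φ f :=
    lt_of_le_of_ne (mul_nonneg (supNorm_nonneg g) (integralNorm_nonneg φ f)) (Ne.symm h0)
  have hg0 : ∃ ud : Ud, 0 < ‖ud‖ := by
    by_contra! h
    have : supNorm _ g ≤ 0 := supNorm_le le_rfl fun w => h _
    exact h0 (by rw [le_antisymm this (supNorm_nonneg g), zero_mul])
  have hf0 : ∃ u : U, 0 < ‖u‖ := by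
    by_contra! h
    have : f = 0 := by
      ext x
      simpa using h ((f : X → U) x)
    exact h0 (by rw [this, integralNorm_zero, mul_zero])
  obtain ⟨ud, hud⟩ := hg0
  obtain ⟨u, hu⟩ := hf0
  have hC0 : 0 ≤ C := by
    by_contra! h
    have h1 : 0 ≤ C * (‖ud‖ * ‖u‖) := by
      rw [← mul_assoc]
      exact (abs_nonneg _).trans (hC ud u)
    exact absurd h1 (not_le.2 (mul_neg_of_neg_of_pos h (mul_pos hud hu)))
  have hP : ‖P‖ ≤ C := P.opNorm_le_bound₂ hC0 hC
  refine (abs_integralPairing_le P g f).trans ?_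
  rw [mul_assoc, mul_assoc]
  gcongr

theorem integralKernel_opUd_eq (x : X) (ud : Ud) :
    (fun w => (integralKernel P φ x w).opUd ud) =
      integralOperator Ud (swap φ) (regularDirac x ud) := by
  rw [integralOperator_regularDirac]
  rfl

theorem integralKernel_opU_eq (w : Ω) (u : U) :
    (fun x => (integralKernel P φ x w).opU u) = integralOperator U φ (regularDirac w u) := by
  rw [integralOperator_regularDirac]
  rfl

/-- The kernel section comes from a Dirac measure at `x`. Fubini turns the pairing into the integral
of `f` against this measure, which evaluates `f` at `x`. -/
theorem integralPairing_kernel_left (x : X) (ud : Ud) (g : adjointSpace Ud φ)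
    (hg : (g : Ω → Ud) = fun w => (integralKernel P φ x w).opUd ud) (f : integralSpace U φ) :
    P ud ((f : X → U) x) = integralPairing P φ g f := by
  obtain ⟨μ, hμ⟩ := f.2
  rw [integralPairing_eq_integral_prod P (ρ := regularDirac x ud)
    (by rw [hg, integralKernel_opUd_eq]) hμ, integral_prod_eq_integral_integralOperator, hμ]
  exact (VectorMeasure.integral_dirac (B := P.flip) (f := (f : X → U))).symm

theorem integralPairing_kernel_right (w : Ω) (u : U) (f : integralSpace U φ)
    (hf : (f : X → U) = fun x => (integralKernel P φ x w).opU u) (g : adjointSpace Ud φ) :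
    P ((g : Ω → Ud) w) u = integralPairing P φ g f := by
  rw [integralPairing_apply P g (μ := regularDirac w u) (by rw [hf, integralKernel_opU_eq])]
  exact (VectorMeasure.integral_dirac (B := P) (f := (g : Ω → Ud))).symm

end Pairing

/-! ### Nondegeneracy from the reproducing properties -/

section General

variable {X Ω U Ud : Type*}
  [NormedAddCommGroup U] [NormedSpace ℝ U] [NormedAddCommGroup Ud] [NormedSpace ℝ Ud]

/-- Nondegeneracy of the pairing of the function spaces follows from nondegeneracy of the pairing
of the output spaces and from the reproducing properties. -/
theorem nondegenerate_of_reproducing {P : Ud →ₗ[ℝ] U →ₗ[ℝ] ℝ} (hP : P.Nondegenerate)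
    {B : Submodule ℝ (X → U)} {Bd : Submodule ℝ (Ω → Ud)} (p : Bd →ₗ[ℝ] B →ₗ[ℝ] ℝ)
    (h : ∀ x ud, ∃ k : Bd, ∀ f : B, P ud ((f : X → U) x) = p k f)
    (h' : ∀ w u, ∃ k : B, ∀ g : Bd, P ((g : Ω → Ud) w) u = p g k) : p.Nondegenerate := by
  refine ⟨fun g hg => ?_, fun f hf => ?_⟩
  · ext w
    refine hP.1 _ fun u => ?_
    obtain ⟨k, hk⟩ := h' w u
    rw [hk, hg]
  · ext x
    refine hP.2 _ fun ud => ?_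
    obtain ⟨k, hk⟩ := h x ud
    rw [hk, hf]

end General

end VVRKBS

/-! ### The adjoint pair: existence and uniqueness of the pairing -/

theorem mainTheorem4 {X Ω U Ud : Type*}
    [TopologicalSpace X] [LocallyCompactSpace X] [T2Space X] [MeasurableSpace X] [BorelSpace X]
    [TopologicalSpace Ω] [LocallyCompactSpace Ω] [T2Space Ω] [MeasurableSpace Ω] [BorelSpace Ω]
    [NormedAddCommGroup U] [NormedSpace ℝ U] [CompleteSpace U]
    [NormedAddCommGroup Ud] [NormedSpace ℝ Ud] [CompleteSpace Ud]
    (P : Ud →L[ℝ] U →L[ℝ] ℝ) (hP : P.toLinearMap₁₂.Nondegenerate) (φ : C₀(X × Ω, ℝ)) :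
    let B : Submodule ℝ (X → U) := VVRKBS.integralSpace U φ
    let Bd₀ : Submodule ℝ (Ω → Ud) := VVRKBS.integralSpace Ud (VVRKBS.swap φ)
    let Bd : Submodule ℝ (Ω → Ud) := VVRKBS.uniformClosure Bd₀
    let K := VVRKBS.integralKernel P φ
    ∃! p : Bd →ₗ[ℝ] B →ₗ[ℝ] ℝ,
      -- the pairing is given by the product measure, for all representatives
      (∀ (ρ : VVRKBS.regularMeasures X Ud) (μ : VVRKBS.regularMeasures Ω U) (g : Bd) (f : B),
        VVRKBS.integralOperator Ud (VVRKBS.swap φ) ρ = (g : Ω → Ud) →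
        VVRKBS.integralOperator U φ μ = (f : X → U) →
        p g f = ∫ᵛ z, φ z ∂•((ρ : VectorMeasure X Ud).prod (μ : VectorMeasure Ω U) P)) ∧
      -- continuity, with the constant of the pairing of the output spaces
      (∀ C : ℝ, (∀ ud u, |P ud u| ≤ C * ‖ud‖ * ‖u‖) →
        ∀ g f, |p g f| ≤ C * VVRKBS.supNorm Bd g * VVRKBS.integralNorm U φ f) ∧
      -- the pair formed by `B` and the uniform closure of `Bd₀` is an adjoint pair of vv-RKBSs
      VVRKBS.IsAdjointPair P.toLinearMap₁₂ B (VVRKBS.integralNorm U φ) Bd (VVRKBS.supNorm Bd)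
        p K ∧
      -- on the space `Bd₀` itself everything holds except possibly completeness of `Bd₀`
      VVRKBS.IsNormedFunctionSpace Bd₀ (VVRKBS.supNorm Bd₀) ∧
      VVRKBS.IsReproducingPair P.toLinearMap₁₂ B (VVRKBS.integralNorm U φ) Bd₀
        (VVRKBS.supNorm Bd₀) (p ∘ₗ Submodule.inclusion (VVRKBS.le_uniformClosure Bd₀)) K := by
  intro B Bd₀ Bd K
  have hb : VVRKBS.IsBoundedSpace Bd₀ := VVRKBS.isBoundedSpace_integralSpace _
  have hk₀ : ∀ x ud, (fun w => (K x w).opUd ud) ∈ Bd₀ := fun x ud =>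
    ⟨VVRKBS.regularDirac x ud, (VVRKBS.integralKernel_opUd_eq P x ud).symm⟩
  have hkB : ∀ w u, (fun x => (K x w).opU u) ∈ B := fun w u =>
    ⟨VVRKBS.regularDirac w u, (VVRKBS.integralKernel_opU_eq P w u).symm⟩
  have hk : ∀ x ud, (fun w => (K x w).opUd ud) ∈ Bd := fun x ud =>
    VVRKBS.le_uniformClosure _ (hk₀ x ud)
  have hleft : ∀ x ud (g : Bd), ((g : Ω → Ud) = fun w => (K x w).opUd ud) → ∀ f : B,
      P ud ((f : X → U) x) = VVRKBS.integralPairing P φ g f :=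
    VVRKBS.integralPairing_kernel_left P
  have hright : ∀ w u (f : B), ((f : X → U) = fun x => (K x w).opU u) → ∀ g : Bd,
      P ((g : Ω → Ud) w) u = VVRKBS.integralPairing P φ g f :=
    VVRKBS.integralPairing_kernel_right P
  refine ⟨VVRKBS.integralPairing P φ, ⟨?_, ?_, ?_, hb.isNormedFunctionSpace, ?_⟩, ?_⟩
  · exact fun ρ μ g f hg hf => VVRKBS.integralPairing_eq_integral_prod P hg hf
  · exact fun C hC g f => VVRKBS.abs_integralPairing_le_of_bound P hC g f
  · exact
      { nondegenerate_output := hP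
        nondegenerate := VVRKBS.nondegenerate_of_reproducing hP _
          (fun x ud => ⟨⟨_, hk x ud⟩, hleft x ud _ rfl⟩)
          (fun w u => ⟨⟨_, hkB w u⟩, hright w u _ rfl⟩)
        continuous := ⟨‖P‖, P.opNorm_nonneg, VVRKBS.abs_integralPairing_le P⟩
        reproducing := fun x ud => ⟨hk x ud, hleft x ud _ rfl⟩
        reproducing_adjoint := fun w u => ⟨hkB w u, hright w u _ rfl⟩
        isVVRKBS := VVRKBS.isVVRKBS_integralSpace
        isVVRKBS_adjoint := hb.isVVRKBS_uniformClosure }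
  · exact
      { nondegenerate_output := hP
        nondegenerate := VVRKBS.nondegenerate_of_reproducing hP _
          (fun x ud => ⟨⟨_, hk₀ x ud⟩, hleft x ud ⟨_, hk x ud⟩ rfl⟩)
          (fun w u => ⟨⟨_, hkB w u⟩, fun g => hright w u _ rfl (Submodule.inclusion _ g)⟩)
        continuous := ⟨‖P‖, P.opNorm_nonneg, fun g f =>
          VVRKBS.abs_integralPairing_le P (Submodule.inclusion (VVRKBS.le_uniformClosure _) g) f⟩
        reproducing := fun x ud => ⟨hk₀ x ud, hleft x ud ⟨_, hk x ud⟩ rfl⟩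
        reproducing_adjoint := fun w u =>
          ⟨hkB w u, fun g => hright w u _ rfl (Submodule.inclusion _ g)⟩ }
  · rintro q ⟨hq, hqC, -⟩
    refine LinearMap.ext₂ fun g f => ?_
    obtain ⟨μ, hμ⟩ := f.2
    obtain ⟨k, hk, hgk⟩ := VVRKBS.exists_seq_of_mem_uniformClosure g.2
    let k' : ℕ → Bd := fun n => ⟨k n, VVRKBS.le_uniformClosure _ (hk n)⟩
    -- Uniqueness by density: the bound with `C = ‖P‖` makes both pairings continuous in `g`, and
    -- the product formula makes them agree on the approximants `k' n`.
    have hlim : ∀ r : Bd →ₗ[ℝ] B →ₗ[ℝ] ℝ,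
        (∀ g f, |r g f| ≤ ‖P‖ * VVRKBS.supNorm Bd g * VVRKBS.integralNorm U φ f) →
        Tendsto (fun n => r (k' n) f) atTop (𝓝 (r g f)) := fun r hr => by
      rw [tendsto_iff_norm_sub_tendsto_zero]
      have h0 : Tendsto (fun n : ℕ => ‖P‖ * (1 / ((n : ℝ) + 1)) * VVRKBS.integralNorm U φ f) atTop
          (𝓝 0) := by
        simpa using (tendsto_one_div_add_atTop_nhds_zero_nat.const_mul ‖P‖).mul_const
          (VVRKBS.integralNorm U φ f)
      refine squeeze_zero (fun _ => norm_nonneg _) (fun n => ?_) h0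
      rw [norm_sub_rev, ← LinearMap.sub_apply, ← map_sub]
      refine (hr _ f).trans ?_
      have := VVRKBS.integralNorm_nonneg φ f
      gcongr
      exact VVRKBS.supNorm_le (by positivity) (hgk n)
    refine tendsto_nhds_unique (hlim q (hqC ‖P‖ P.le_opNorm₂))
      ((hlim _ (VVRKBS.abs_integralPairing_le P)).congr fun n => ?_)
    obtain ⟨ρ, hρ⟩ := hk n
    rw [hq ρ μ (k' n) f hρ hμ]
    exact VVRKBS.integralPairing_eq_integral_prod P hρ hμ
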